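/- Let $L$ be a finite-dimensional Lie algebra over an arbitrary field $F$. Definitions. The core $M_L$ of a subalgebra $M$ is the largest ideal of $L$ contained in $M$. A Lie algebra is primitive if it has a maximal subalgebra with zero core; it is primitive of type 2 if it is primitive and has a unique minimal ideal, which is non-abelian, and primitive of type 3 if it is primitive and has precisely two distinct minimal ideals, each of which is non-abelian. A chief factor $A/B$ of $L$ is a pair of ideals $B\subsetneq A$ with no ideal of $L$ strictly between them; its centraliser is $C_L(A/B)=\{x\in L : [x,A]\subseteq B\}$. A proper subalgebra $M$ supplements $A/B$ if $L=A+M$ and $B\subseteq A\cap M$, and $A/B$ is supplemented if such an $M$ exists. Two chief factors are $L$-isomorphic if there is an isomorphism between them that is both an isomorphism of $L$-modules and an isomorphism of Lie algebras. They are $L$-connected if they are $L$-isomorphic, or if some quotient $L/N$ is primitive of type 3 and its two minimal ideals are $L$-isomorphic, respectively, to the two given factors. A maximal subalgebra $M$ is monolithic if $L/M_L$ is primitive and has a unique minimal ideal. The crown associated with a supplemented chief factor $A/B$ is $R/S$, where $R=A+C_L(A/B)$ and $S$ is the intersection of the cores $M_L$ of all monolithic maximal subalgebras $M$ of $L$ that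 supplement some chief factor $L$-connected to $A/B$. Proposition. Each of the following four ideals is equal to the solvable radical $\Gamma$ of $L$ (the intersection of an empty family being $L$): \begin{align*} &\bigcap\{S : \text{there is a non-abelian crown } R/S \text{ of } L\},\\ &\bigcap\{M_L : M \text{ is a maximal subalgebra of } L \text{ and } L/M_L \text{ is primitive of type } 2\},\\ &\bigcap\{M_L : M \text{ is a maximal subalgebra of } L \text{ and } L/M_L \text{ is primitive of type } 2 \text{ or } 3\},\\ &\bigcap\{C_L(A/B) : A/B \text{ is a non-abelian chief factor of } L\}. \end{align*} -/

import Mathlib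

namespace LieCrown

section Algebra

variable (F L : Type*) [Field F] [LieRing L] [LieAlgebra F L]

/-- The core `U_L` of a subalgebra `U` of `L`: the largest ideal of `L` contained in `U`
(see `isGreatest_core`). -/
def core {F L : Type*} [Field F] [LieRing L] [LieAlgebra F L] (U : LieSubalgebra F L) :
    LieIdeal F L :=
  sSup {I : LieIdeal F L | (I : Set L) ⊆ U}

theorem isGreatest_core {F L : Type*} [Field F] [LieRing L] [LieAlgebra F L]
    (U : LieSubalgebra F L) : IsGreatest {I : LieIdeal F L | (I : Set L) ⊆ U} (core U) := by
  refine ⟨?_, fun I hI => le_sSup hI⟩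
  have h : (core U).toSubmodule ≤ U.toSubmodule := by
    unfold core
    rw [LieSubmodule.sSup_toSubmodule]
    refine sSup_le ?_
    rintro _ ⟨I, hI, rfl⟩
    exact hI
  exact h

/-- `M` is a maximal (proper) subalgebra with zero core. -/
def IsCoreFreeMaximal {F L : Type*} [Field F] [LieRing L] [LieAlgebra F L]
    (M : LieSubalgebra F L) : Prop :=
  IsCoatom M ∧ core M = ⊥

/-- `L` is primitive: it has a core-free maximal subalgebra. -/
def IsPrimitive : Prop :=
  ∃ M : LieSubalgebra F L, IsCoreFreeMaximal M

/-- `L` is monolithic: it has a unique minimal ideal. -/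
def IsMonolithic : Prop :=
  ∃! W : LieIdeal F L, IsAtom W

/-- Primitive of type 2: primitive, with a unique minimal ideal, which is non-abelian. -/
def IsPrimitiveType2 : Prop :=
  IsPrimitive F L ∧
    ∃ W : LieIdeal F L, {I : LieIdeal F L | IsAtom I} = {W} ∧ ¬ IsLieAbelian W

/-- Primitive of type 3: primitive, with precisely two distinct minimal ideals, each of which is
non-abelian. -/
def IsPrimitiveType3 : Prop :=
  IsPrimitive F L ∧
    ∃ V W : LieIdeal F L, V ≠ W ∧ {I : LieIdeal F L | IsAtom I} = {V, W} ∧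
      ¬ IsLieAbelian V ∧ ¬ IsLieAbelian W

end Algebra

section Factors

variable {F L : Type*} [Field F] [LieRing L] [LieAlgebra F L]

/-- `A / B` is a chief factor of `L`: `B < A` are ideals with no ideal strictly between them. -/
def IsChiefFactor (A B : LieIdeal F L) : Prop :=
  B ⋖ A

/-- The factor algebra `A / B` (for ideals `B ≤ A`) is abelian, that is, `[A, A] ⊆ B`. -/
def IsAbelianFactor (A B : LieIdeal F L) : Prop :=
  ∀ x ∈ A, ∀ y ∈ A, ⁅x, y⁆ ∈ B

/-- The centraliser `C_L(A/B) = {x ∈ L : [x, A] ⊆ B}`, an ideal of `L`. -/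
def factorCentralizer (A B : LieIdeal F L) : LieIdeal F L where
  carrier := {x | ∀ a ∈ A, ⁅x, a⁆ ∈ B}
  add_mem' := by
    intro x y hx hy a ha
    rw [add_lie]
    exact add_mem (hx a ha) (hy a ha)
  zero_mem' := by
    intro a _
    rw [zero_lie]
    exact zero_mem B
  smul_mem' := by
    intro c x hx a ha
    rw [smul_lie]
    exact B.smul_mem c (hx a ha)
  lie_mem := by
    intro y x hx a ha
    rw [lie_lie]
    exact sub_mem (B.lie_mem (hx a ha)) (hx _ (A.lie_mem ha))

/-- The factor `A / B` as an `L`-module (for ideals `B ≤ A`). -/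
abbrev Factor (A B : LieIdeal F L) : Type _ :=
  A ⧸ LieSubmodule.comap (LieSubmodule.incl A) B

/-- The class in `A / B` of an element of `A`. -/
abbrev toFactor (A B : LieIdeal F L) : A →ₗ⁅F, L⁆ Factor A B :=
  LieSubmodule.Quotient.mk' (LieSubmodule.comap (LieSubmodule.incl A) B)

/-- `A₁ / B₁` and `A₂ / B₂` are `L`-isomorphic: there is an isomorphism of `L`-modules between
them which is also an isomorphism of algebras. -/
def LIsomorphic (A₁ B₁ A₂ B₂ : LieIdeal F L) : Prop :=
  ∃ e : Factor A₁ B₁ ≃ₗ⁅F, L⁆ Factor A₂ B₂,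
    ∀ (x y : A₁) (x' y' : A₂), e (toFactor A₁ B₁ x) = toFactor A₂ B₂ x' →
      e (toFactor A₁ B₁ y) = toFactor A₂ B₂ y' →
      e (toFactor A₁ B₁ ⁅x, y⁆) = toFactor A₂ B₂ ⁅x', y'⁆

/-- `A₁ / B₁` and `A₂ / B₂` are `L`-connected: either they are `L`-isomorphic, or some epimorphic
image `L / N` of `L` is primitive of type 3 and its two minimal ideals `E₁ / N`, `E₂ / N` are
`L`-isomorphic to `A₁ / B₁`, `A₂ / B₂` respectively. -/
def LConnected (A₁ B₁ A₂ B₂ : LieIdeal F L) : Prop :=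
  LIsomorphic A₁ B₁ A₂ B₂ ∨
    ∃ N E₁ E₂ : LieIdeal F L, IsPrimitiveType3 F (L ⧸ N) ∧
      IsChiefFactor E₁ N ∧ IsChiefFactor E₂ N ∧ E₁ ≠ E₂ ∧
      LIsomorphic E₁ N A₁ B₁ ∧ LIsomorphic E₂ N A₂ B₂

/-- The proper subalgebra `M` is a supplement of `A / B` in `L`: `L = A + M` and `B ⊆ A ∩ M`. -/
def Supplements (M : LieSubalgebra F L) (A B : LieIdeal F L) : Prop :=
  M ≠ ⊤ ∧ A.toSubmodule ⊔ M.toSubmodule = ⊤ ∧ B.toSubmodule ≤ A.toSubmodule ⊓ M.toSubmodule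

/-- `A / B` is a supplemented factor of `L`. -/
def IsSupplemented (A B : LieIdeal F L) : Prop :=
  ∃ M : LieSubalgebra F L, Supplements M A B

/-- `M` is a monolithic maximal subalgebra of `L`: `M` is a maximal subalgebra and `L / M_L` is
primitive and monolithic. -/
def IsMonolithicMaximal (M : LieSubalgebra F L) : Prop :=
  IsCoatom M ∧ IsPrimitive F (L ⧸ core M) ∧ IsMonolithic F (L ⧸ core M)

/-- The numerator `A + C_L(A/B)` of the crown associated with `A / B`. -/
def crownTop (A B : LieIdeal F L) : LieIdeal F L :=
  A ⊔ factorCentralizer A B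

/-- The denominator of the crown associated with `A / B`: the intersection of the cores `M_L` of
the monolithic maximal subalgebras `M` of `L` that supplement a chief factor `E / D` of `L` which
is `L`-connected to `A / B`. -/
def crownBot (A B : LieIdeal F L) : LieIdeal F L :=
  sInf {N | ∃ M : LieSubalgebra F L, N = core M ∧ IsMonolithicMaximal M ∧
    ∃ E D : LieIdeal F L, IsChiefFactor E D ∧ LConnected E D A B ∧ Supplements M E D}

/-- `R / S` is a crown of `L`: the crown associated with some supplemented chief factor. -/
def IsCrown (R S : LieIdeal F L) : Prop :=
  ∃ A B : LieIdeal F L, IsChiefFactor A B ∧ IsSupplemented A B ∧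
    R = crownTop A B ∧ S = crownBot A B

end Factors

end LieCrown

/-!
Everything is compared with the centralisers of the non-abelian chief factors.

Their intersection is the radical `Γ`. On one side, a non-abelian chief factor `A / B` is perfect, so
that `Γ ∩ A ⊆ B` and `Γ` centralises `A / B` (`radical_le_factorCentralizer`). On the other side, an
ideal `C ⊄ Γ` that centralises every non-abelian chief factor would give a chief factor `X / Γ` with
`X ⊆ C + Γ`; it is non-abelian since `X` is not solvable, but it is centralised by `C + Γ ⊇ X`
(`le_radical_of_forall_le_factorCentralizer`).

The centraliser `C` of a non-abelian chief factor `A / B` is itself the core of a maximal subalgebra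
`M` which supplements `A / B` and for which `L / C` is primitive of type 2
(`exists_isCoatom_core_eq_factorCentralizer`). Indeed `(A + C) / C` is a minimal
ideal of `L / C` with trivial centraliser, hence the only minimal ideal, and all that is needed is a
maximal subalgebra not containing it. This is a form of the nilpotency of the Frattini ideal: by Fitting's lemma the
Engel subalgebra of an element `x` of an ideal `W` satisfies `L = engel x + W`; if `W` lies in every
maximal subalgebra, then `ad x` is nilpotent for every `x ∈ W`, and `W` is nilpotent by Engel's theorem
(`exists_isCoatom_not_le_of_isAtom`).

Conversely, `Γ ⊆ N` as soon as no minimal ideal of `L / N` is abelian (`radical_le_of_isAtom`). This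
takes care of the quotients of type 2 and 3, and of the maximal subalgebras occurring in the crown of
a non-abelian chief factor. Finally, the crown of an abelian chief factor is abelian
(`isAbelianFactor_crown`): if `M` supplements an abelian `E / D`, then `C_L(E/D) ∩ M` is an ideal, so
`C_L(E/D) ⊆ E + M_L`, and `[E + M_L, E + M_L] ⊆ M_L`.
-/

namespace LieCrown

variable {F L : Type*} [Field F] [LieRing L] [LieAlgebra F L]

/-! ### Chief factors and the solvable radical -/

theorem isAbelianFactor_iff_le_factorCentralizer {A B : LieIdeal F L} :
    IsAbelianFactor A B ↔ A ≤ factorCentralizer A B :=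
  Iff.rfl

theorem isAbelianFactor_iff_lie_le {A B : LieIdeal F L} :
    IsAbelianFactor A B ↔ ⁅A, A⁆ ≤ B := by
  rw [LieSubmodule.lie_le_iff]
  rfl

theorem le_factorCentralizer (A B : LieIdeal F L) : B ≤ factorCentralizer A B :=
  fun x hx a _ => lie_mem_left F L B x a hx

/-- A non-abelian chief factor is perfect. -/
theorem IsChiefFactor.lie_sup_eq {A B : LieIdeal F L} (h : IsChiefFactor A B)
    (hna : ¬ IsAbelianFactor A B) : ⁅A, A⁆ ⊔ B = A := by
  rcases h.eq_or_eq (c := ⁅A, A⁆ ⊔ B) le_sup_right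
    (sup_le (LieSubmodule.lie_le_left A A) h.le) with h1 | h1
  · exact absurd (isAbelianFactor_iff_lie_le.2 (sup_eq_right.1 h1)) hna
  · exact h1

theorem IsChiefFactor.inf_factorCentralizer {A B : LieIdeal F L} (h : IsChiefFactor A B)
    (hna : ¬ IsAbelianFactor A B) : A ⊓ factorCentralizer A B = B := by
  rcases h.eq_or_eq (le_inf h.le (le_factorCentralizer A B)) inf_le_left with h1 | h1
  · exact h1
  · exact absurd (isAbelianFactor_iff_le_factorCentralizer.2 (inf_eq_left.1 h1)) hna

theorem isSolvable_iff_exists_derivedSeriesOfIdeal {I : LieIdeal F L} :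
    LieAlgebra.IsSolvable I ↔ ∃ k, LieAlgebra.derivedSeriesOfIdeal F L k I = ⊥ := by
  simp_rw [LieAlgebra.isSolvable_iff F, LieIdeal.derivedSeries_eq_bot_iff]

theorem radical_le_factorCentralizer [FiniteDimensional F L] {A B : LieIdeal F L}
    (h : IsChiefFactor A B) (hna : ¬ IsAbelianFactor A B) :
    LieAlgebra.radical F L ≤ factorCentralizer A B := by
  set G := LieAlgebra.radical F L with hG
  rcases h.eq_or_eq (c := G ⊓ A ⊔ B) le_sup_right (sup_le inf_le_right h.le) with h1 | h1
  · intro x hx a ha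
    exact sup_eq_right.1 h1 ⟨lie_mem_left F L G x a hx, A.lie_mem ha⟩
  · exfalso
    -- Perfectness of `A / B` propagates `A = (Γ ∩ A) + B` along the derived series.
    have key : ∀ k, A ≤ LieAlgebra.derivedSeriesOfIdeal F L k G ⊔ B := by
      intro k
      induction k with
      | zero =>
        rw [LieAlgebra.derivedSeriesOfIdeal_zero]
        exact h1.symm.le.trans (sup_le_sup_right inf_le_left B)
      | succ k ih =>
        rw [LieAlgebra.derivedSeriesOfIdeal_succ]
        refine (h.lie_sup_eq hna).symm.le.trans (sup_le ?_ le_sup_right)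
        refine (LieSubmodule.mono_lie ih ih).trans ?_
        rw [LieSubmodule.lie_sup, LieSubmodule.sup_lie]
        exact sup_le (sup_le_sup_left (LieSubmodule.lie_le_left B _) _)
          ((LieSubmodule.lie_le_right B _).trans le_sup_right)
    obtain ⟨k, hk⟩ := isSolvable_iff_exists_derivedSeriesOfIdeal.1
      (LieAlgebra.radicalIsSolvable F L)
    have := key k
    rw [hk, bot_sup_eq] at this
    exact h.lt.not_ge this

theorem le_radical_of_forall_le_factorCentralizer [FiniteDimensional F L] {C : LieIdeal F L}
    (hC : ∀ A B : LieIdeal F L, IsChiefFactor A B → ¬ IsAbelianFactor A B →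
      C ≤ factorCentralizer A B) : C ≤ LieAlgebra.radical F L := by
  set G := LieAlgebra.radical F L with hG
  by_contra hCG
  have := LieSubmodule.wellFoundedLT_of_isArtinian F L L
  obtain ⟨X, hX, hXC⟩ := exists_covBy_le_of_lt (right_lt_sup.2 hCG)
  have hna : ¬ IsAbelianFactor X G := by
    intro hab
    apply hX.lt.not_ge
    rw [hG, ← LieAlgebra.LieIdeal.solvable_iff_le_radical,
      isSolvable_iff_exists_derivedSeriesOfIdeal]
    obtain ⟨k, hk⟩ := isSolvable_iff_exists_derivedSeriesOfIdeal.1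
      (LieAlgebra.radicalIsSolvable F L)
    refine ⟨k + 1, ?_⟩
    rw [LieAlgebra.derivedSeriesOfIdeal_add, eq_bot_iff, ← hk]
    exact LieAlgebra.derivedSeriesOfIdeal_mono (isAbelianFactor_iff_lie_le.1 hab) k
  exact hna (isAbelianFactor_iff_le_factorCentralizer.2
    (hXC.trans (sup_le (hC X G hX hna) (le_factorCentralizer X G))))

/-! ### Minimal ideals of a quotient -/

/-- The canonical projection onto a quotient, as a morphism of Lie algebras (Mathlib's
`LieSubmodule.Quotient.mk'` is only a morphism of `L`-modules). -/
def quotientHom (N : LieIdeal F L) : L →ₗ⁅F⁆ L ⧸ N :=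
  { (LieSubmodule.Quotient.mk' N : L →ₗ[F] L ⧸ N) with
    map_lie' := fun {x y} => LieSubmodule.Quotient.mk_bracket N x y }

theorem quotientHom_surjective (N : LieIdeal F L) : Function.Surjective (quotientHom N) :=
  LieSubmodule.Quotient.surjective_mk' N

theorem quotientHom_eq_zero {N : LieIdeal F L} {x : L} : quotientHom N x = 0 ↔ x ∈ N :=
  LieSubmodule.Quotient.mk_eq_zero N

theorem ker_quotientHom (N : LieIdeal F L) : (quotientHom N).ker = N := by
  ext x
  rw [LieHom.mem_ker, quotientHom_eq_zero]

theorem comap_map_quotientHom (N X : LieIdeal F L) :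
    (X.map (quotientHom N)).comap (quotientHom N) = X ⊔ N := by
  rw [LieIdeal.comap_map_eq
      (congrArg SetLike.coe (LieIdeal.coe_map_of_surjective (quotientHom_surjective N))),
    ker_quotientHom]

theorem map_comap_quotientHom (N : LieIdeal F L) (J : LieIdeal F (L ⧸ N)) :
    (J.comap (quotientHom N)).map (quotientHom N) = J := by
  rw [LieIdeal.map_comap_eq (LieHom.isIdealMorphism_of_surjective _ (quotientHom_surjective N)),
    LieHom.idealRange_eq_top_of_surjective _ (quotientHom_surjective N), top_inf_eq]

theorem isAtom_map_quotientHom {N X : LieIdeal F L} (h : N ⋖ X) :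
    IsAtom (X.map (quotientHom N)) := by
  refine ⟨fun h0 => ?_, fun J hJ => ?_⟩
  · rw [LieIdeal.map_eq_bot_iff, ker_quotientHom] at h0
    exact h.lt.not_ge h0
  · have h1 : N ≤ J.comap (quotientHom N) := by
      simpa only [ker_quotientHom] using LieHom.ker_le_comap (quotientHom N) J
    have h2 : J.comap (quotientHom N) ≤ X :=
      (LieIdeal.comap_mono hJ.le).trans
        (by rw [comap_map_quotientHom, sup_eq_left.2 h.le])
    rcases h.eq_or_eq h1 h2 with h3 | h3
    · rw [← map_comap_quotientHom N J, h3, LieIdeal.map_eq_bot_iff, ker_quotientHom]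
    · rw [← h3, map_comap_quotientHom] at hJ
      exact absurd hJ (lt_irrefl _)

/-- If `A / B` is a chief factor and `A ∩ N = B`, then the image of `A` in `L / N` is a minimal
ideal. -/
theorem IsChiefFactor.isAtom_map {A B N : LieIdeal F L} (h : IsChiefFactor A B)
    (hN : A ⊓ N = B) : IsAtom (A.map (quotientHom N)) := by
  have h1 : N ⋖ A ⊔ N := covBy_sup_of_inf_covBy_left (by rw [hN]; exact h)
  have h2 := isAtom_map_quotientHom h1
  rwa [LieIdeal.map_sup, (LieIdeal.map_eq_bot_iff (I := N)).2 (ker_quotientHom N).ge,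
    sup_bot_eq] at h2

theorem isLieAbelian_map_quotientHom_iff {N A : LieIdeal F L} :
    IsLieAbelian (A.map (quotientHom N)) ↔ IsAbelianFactor A N := by
  constructor
  · intro h x hx y hy
    rw [← quotientHom_eq_zero, LieHom.map_lie]
    exact congrArg Subtype.val (h.trivial ⟨_, LieIdeal.mem_map hx⟩ ⟨_, LieIdeal.mem_map hy⟩)
  · refine fun h => ⟨fun ⟨u, hu⟩ ⟨v, hv⟩ => ?_⟩
    obtain ⟨x, rfl⟩ := LieIdeal.mem_map_of_surjective (quotientHom_surjective N) hu
    obtain ⟨y, rfl⟩ := LieIdeal.mem_map_of_surjective (quotientHom_surjective N) hv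
    apply Subtype.ext
    change ⁅quotientHom N x, quotientHom N y⁆ = 0
    rw [← LieHom.map_lie, quotientHom_eq_zero]
    exact h _ x.2 _ y.2

theorem radical_le_of_isAtom [FiniteDimensional F L] {N : LieIdeal F L}
    (h : ∀ W : LieIdeal F (L ⧸ N), IsAtom W → ¬ IsLieAbelian W) :
    LieAlgebra.radical F L ≤ N := by
  by_contra hN
  have := LieSubmodule.wellFoundedLT_of_isArtinian F L L
  obtain ⟨X, hX, hXN⟩ := exists_covBy_le_of_lt (right_lt_sup.2 hN)
  have hna : ¬ IsAbelianFactor X N := fun hab =>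
    h _ (isAtom_map_quotientHom hX) (isLieAbelian_map_quotientHom_iff.2 hab)
  exact hna (isAbelianFactor_iff_le_factorCentralizer.2
    (hXN.trans (sup_le (radical_le_factorCentralizer hX hna) (le_factorCentralizer X N))))

theorem IsPrimitiveType2.not_isLieAbelian (h : IsPrimitiveType2 F L) {W : LieIdeal F L}
    (hW : IsAtom W) : ¬ IsLieAbelian W := by
  obtain ⟨-, V, hV, hna⟩ := h
  obtain rfl : W = V := by simpa using hV.subset hW
  exact hna

theorem IsPrimitiveType3.not_isLieAbelian (h : IsPrimitiveType3 F L) {W : LieIdeal F L}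
    (hW : IsAtom W) : ¬ IsLieAbelian W := by
  obtain ⟨-, V₁, V₂, -, hV, hna₁, hna₂⟩ := h
  obtain rfl | rfl : W = V₁ ∨ W = V₂ := by simpa using hV.subset hW
  exacts [hna₁, hna₂]

/-! ### Maximal subalgebras avoiding a minimal ideal -/

/-- A form of the nilpotency of the Frattini ideal. -/
theorem exists_isCoatom_not_le_of_isAtom [FiniteDimensional F L] {W : LieIdeal F L}
    (hW : IsAtom W) (hna : ¬ IsLieAbelian W) :
    ∃ M : LieSubalgebra F L, IsCoatom M ∧ ¬ W.toSubmodule ≤ M.toSubmodule := by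
  by_contra! hM
  have hengel : ∀ x ∈ W, LieSubalgebra.engel F x = ⊤ := by
    intro x hx
    by_contra hne
    have := LieSubalgebra.wellFoundedGT_of_noetherian F L
    obtain ⟨M, hMc, hxM⟩ := (eq_top_or_exists_le_coatom (LieSubalgebra.engel F x)).resolve_left hne
    apply hMc.1
    -- Fitting's lemma; the exponent is taken positive so that the range lies in `W`.
    obtain ⟨n, hn, hn1⟩ := ((LieAlgebra.ad F L x).eventually_isCompl_ker_pow_range_pow.and
      (Filter.eventually_ge_atTop 1)).exists
    rw [← LieSubalgebra.toSubmodule_inj, LieSubalgebra.top_toSubmodule, eq_top_iff,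
      ← hn.sup_eq_top]
    refine sup_le (fun y hy => hxM ?_) (le_trans ?_ (hM M hMc))
    · exact (LieSubalgebra.mem_engel_iff F x y).2 ⟨n, hy⟩
    · rintro _ ⟨y, rfl⟩
      obtain ⟨m, rfl⟩ := Nat.exists_eq_add_of_le' hn1
      rw [pow_succ']
      exact lie_mem_left F L W x _ hx
  have hnil : LieRing.IsNilpotent W := by
    rw [LieAlgebra.isNilpotent_iff_forall (R := F)]
    intro x
    refine LieSubalgebra.isNilpotent_ad_of_isNilpotent_ad (W : LieSubalgebra F L) (x := x) ?_
    rw [Module.End.isNilpotent_iff_of_finite]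
    intro y
    exact (LieSubalgebra.mem_engel_iff F _ y).1 (by rw [hengel _ x.2]; trivial)
  have hsol : LieAlgebra.IsSolvable W := inferInstance
  obtain ⟨k, hk⟩ := isSolvable_iff_exists_derivedSeriesOfIdeal.1 hsol
  have hperf : ∀ k, LieAlgebra.derivedSeriesOfIdeal F L k W = W := by
    intro k
    induction k with
    | zero => exact LieAlgebra.derivedSeriesOfIdeal_zero F L W
    | succ k ih =>
      rw [LieAlgebra.derivedSeriesOfIdeal_succ, ih]
      refine (hW.le_iff.1 (LieSubmodule.lie_le_left W W)).resolve_left fun h0 => ?_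
      exact hna ((LieSubmodule.lie_abelian_iff_lie_self_eq_bot W).2 h0)
  exact hW.1 ((hperf k).symm.trans hk)

/-- A minimal ideal with trivial centraliser is contained in every non-zero ideal. -/
theorem le_of_forall_centralizer_eq_zero {W I : LieIdeal F L} (hW : IsAtom W)
    (hC : ∀ x : L, (∀ w ∈ W, ⁅x, w⁆ = 0) → x = 0) (hI : I ≠ ⊥) : W ≤ I := by
  by_contra hWI
  have hinf : W ⊓ I = ⊥ := (hW.le_iff.1 inf_le_left).resolve_right fun h => hWI (inf_eq_left.1 h)
  refine hI ((LieSubmodule.eq_bot_iff I).2 fun x hx => hC x fun w hw => ?_)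
  rw [← LieSubmodule.mem_bot (R := F) (L := L), ← hinf]
  exact ⟨W.lie_mem hw, lie_mem_left F L I x w hx⟩

theorem core_le (M : LieSubalgebra F L) : (core M).toSubmodule ≤ M.toSubmodule :=
  (isGreatest_core M).1

theorem le_core {M : LieSubalgebra F L} {I : LieIdeal F L} (h : I.toSubmodule ≤ M.toSubmodule) :
    I ≤ core M :=
  (isGreatest_core M).2 h

theorem sup_toSubmodule_eq_top {M : LieSubalgebra F L} (hM : IsCoatom M) {I : LieIdeal F L}
    (h : ¬ I.toSubmodule ≤ M.toSubmodule) : I.toSubmodule ⊔ M.toSubmodule = ⊤ := by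
  let K : LieSubalgebra F L :=
    { I.toSubmodule ⊔ M.toSubmodule with
      lie_mem' := by
        intro x y hx hy
        obtain ⟨a, ha, m, hm, rfl⟩ := Submodule.mem_sup.1 hx
        obtain ⟨b, hb, n, hn, rfl⟩ := Submodule.mem_sup.1 hy
        rw [add_lie, lie_add m, ← add_assoc]
        exact Submodule.add_mem_sup (add_mem (lie_mem_left F L I a _ ha) (I.lie_mem hb))
          (M.lie_mem hm hn) }
  have hMK : M < K := by
    refine lt_of_le_of_ne (fun x hx => Submodule.mem_sup_right hx) ?_
    rintro hEq
    refine h fun x hx => ?_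
    change x ∈ M
    rw [hEq]
    exact Submodule.mem_sup_left hx
  exact congrArg LieSubalgebra.toSubmodule (hM.2 K hMK)

/-- The centraliser of a non-abelian chief factor is the core of a maximal supplement with primitive
quotient of type 2. -/
theorem exists_isCoatom_core_eq_factorCentralizer [FiniteDimensional F L] {A B : LieIdeal F L}
    (h : IsChiefFactor A B) (hna : ¬ IsAbelianFactor A B) :
    ∃ M : LieSubalgebra F L, core M = factorCentralizer A B ∧ IsCoatom M ∧
      IsPrimitiveType2 F (L ⧸ core M) ∧ Supplements M A B := by
  set C := factorCentralizer A B with hCdef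
  have hAC : A ⊓ C = B := h.inf_factorCentralizer hna
  set W : LieIdeal F (L ⧸ C) := A.map (quotientHom C) with hWdef
  have hW : IsAtom W := h.isAtom_map hAC
  have hWna : ¬ IsLieAbelian W := fun hab => hna fun x hx y hy => by
    rw [← hAC]
    exact ⟨A.lie_mem hy, isLieAbelian_map_quotientHom_iff.1 hab x hx y hy⟩
  have hWC : ∀ q : L ⧸ C, (∀ w ∈ W, ⁅q, w⁆ = 0) → q = 0 := by
    intro q hq
    obtain ⟨x, rfl⟩ := quotientHom_surjective C q
    rw [quotientHom_eq_zero]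
    intro a ha
    rw [← hAC]
    refine ⟨A.lie_mem ha, quotientHom_eq_zero.1 ?_⟩
    rw [LieHom.map_lie]
    exact hq _ (LieIdeal.mem_map ha)
  have hatoms : {I : LieIdeal F (L ⧸ C) | IsAtom I} = {W} := by
    ext I
    refine ⟨fun hI => ?_, fun hI => by rw [Set.mem_singleton_iff.1 hI]; exact hW⟩
    exact ((hI.le_iff.1 (le_of_forall_centralizer_eq_zero hW hWC hI.1)).resolve_left hW.1).symm
  obtain ⟨M', hM', hWM'⟩ := exists_isCoatom_not_le_of_isAtom hW hWna
  have hcore' : core M' = ⊥ := by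
    by_contra hne
    have hle : W.toSubmodule ≤ (core M').toSubmodule :=
      le_of_forall_centralizer_eq_zero hW hWC hne
    exact hWM' (hle.trans (core_le M'))
  have hsup' := sup_toSubmodule_eq_top hM' hWM'
  set M : LieSubalgebra F L := M'.comap (quotientHom C) with hMdef
  have hmem : ∀ x, x ∈ M ↔ quotientHom C x ∈ M' := fun x => Iff.rfl
  have hCM : C.toSubmodule ≤ M.toSubmodule := by
    intro x hx
    change x ∈ M
    rw [hmem, quotientHom_eq_zero.2 hx]
    exact zero_mem _
  have hcore : core M = C := by
    refine le_antisymm ?_ (le_core hCM)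
    have : (core M).map (quotientHom C) ≤ core M' := by
      refine le_core fun q hq => ?_
      obtain ⟨x, rfl⟩ := LieIdeal.mem_map_of_surjective (quotientHom_surjective C) hq
      exact core_le M x.2
    rwa [hcore', le_bot_iff, LieIdeal.map_eq_bot_iff, ker_quotientHom] at this
  have htop : M ≠ ⊤ := by
    intro ht
    apply hM'.1
    rw [eq_top_iff]
    intro q _
    obtain ⟨x, rfl⟩ := quotientHom_surjective C q
    rw [← hmem, ht]
    trivial
  have hM : IsCoatom M := by
    refine ⟨htop, fun K hK => ?_⟩
    have hlt : M' < K.map (quotientHom C) := by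
      refine lt_of_le_of_ne (fun q hq => ?_) fun hEq => hK.not_ge fun x hx => ?_
      · obtain ⟨x, rfl⟩ := quotientHom_surjective C q
        exact ⟨x, hK.le hq, rfl⟩
      · rw [hmem, hEq]
        exact ⟨x, hx, rfl⟩
    have hKt := hM'.2 _ hlt
    rw [eq_top_iff]
    intro x _
    have hx : quotientHom C x ∈ K.map (quotientHom C) := by rw [hKt]; trivial
    obtain ⟨y, hy, hyx⟩ := hx
    have hxy : x - y ∈ C := by
      rw [← quotientHom_eq_zero, map_sub, sub_eq_zero]
      exact hyx.symm
    rw [← sub_add_cancel x y]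
    exact add_mem (hK.le (hCM hxy)) hy
  have hAM : ¬ A.toSubmodule ≤ M.toSubmodule := fun hle => by
    refine hWM' fun q hq => ?_
    obtain ⟨x, rfl⟩ := LieIdeal.mem_map_of_surjective (quotientHom_surjective C) hq
    exact hle x.2
  refine ⟨M, hcore, hM, ?_, htop, sup_toSubmodule_eq_top hM hAM, ?_⟩
  · rw [hcore]
    exact ⟨⟨M', hM', hcore'⟩, W, hatoms, hWna⟩
  · exact le_inf h.le (le_trans (le_factorCentralizer A B) hCM)

/-! ### Isomorphic and connected chief factors -/

theorem toFactor_eq_zero {A B : LieIdeal F L} {x : A} : toFactor A B x = 0 ↔ (x : L) ∈ B :=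
  LieSubmodule.Quotient.mk_eq_zero _

theorem toFactor_surjective (A B : LieIdeal F L) : Function.Surjective (toFactor A B) :=
  LieSubmodule.Quotient.surjective_mk' _

theorem LIsomorphic.refl (A B : LieIdeal F L) : LIsomorphic A B A B := by
  refine ⟨LieModuleEquiv.refl, fun x y x' y' hx hy => ?_⟩
  change toFactor A B x = toFactor A B x' at hx
  change toFactor A B y = toFactor A B y' at hy
  change toFactor A B ⁅x, y⁆ = toFactor A B ⁅x', y'⁆
  rw [← sub_eq_zero, ← map_sub, toFactor_eq_zero] at hx hy ⊢
  have : ((⁅x, y⁆ - ⁅x', y'⁆ : A) : L) =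
      ⁅((x - x' : A) : L), (y : L)⁆ + ⁅(x' : L), ((y - y' : A) : L)⁆ := by
    simp
  rw [this]
  exact add_mem (lie_mem_left F L B _ _ hx) (B.lie_mem hy)

theorem LIsomorphic.symm {A₁ B₁ A₂ B₂ : LieIdeal F L} (h : LIsomorphic A₁ B₁ A₂ B₂) :
    LIsomorphic A₂ B₂ A₁ B₁ := by
  obtain ⟨e, he⟩ := h
  refine ⟨e.symm, fun x y x' y' hx hy => ?_⟩
  have hx' : e (toFactor A₁ B₁ x') = toFactor A₂ B₂ x := by rw [← hx, e.apply_symm_apply]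
  have hy' : e (toFactor A₁ B₁ y') = toFactor A₂ B₂ y := by rw [← hy, e.apply_symm_apply]
  rw [← he x' y' x y hx' hy', e.symm_apply_apply]

theorem LIsomorphic.exists_apply_eq {A₁ B₁ A₂ B₂ : LieIdeal F L}
    (e : Factor A₁ B₁ ≃ₗ⁅F, L⁆ Factor A₂ B₂) (a : A₂) :
    ∃ x : A₁, e (toFactor A₁ B₁ x) = toFactor A₂ B₂ a := by
  obtain ⟨x, hx⟩ := toFactor_surjective A₁ B₁ (e.symm (toFactor A₂ B₂ a))
  exact ⟨x, by rw [hx, e.apply_symm_apply]⟩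

theorem LIsomorphic.factorCentralizer_le {A₁ B₁ A₂ B₂ : LieIdeal F L}
    (h : LIsomorphic A₁ B₁ A₂ B₂) : factorCentralizer A₁ B₁ ≤ factorCentralizer A₂ B₂ := by
  obtain ⟨e, -⟩ := h
  intro x hx a ha
  obtain ⟨y, hy⟩ := LIsomorphic.exists_apply_eq e ⟨a, ha⟩
  have h0 : toFactor A₁ B₁ ⁅x, y⁆ = 0 := toFactor_eq_zero.2 (hx y y.2)
  have h1 : toFactor A₂ B₂ ⁅x, (⟨a, ha⟩ : A₂)⁆ = 0 := by
    rw [LieModuleHom.map_lie, ← hy, ← LieModuleEquiv.coe_toLieModuleHom, ← LieModuleHom.map_lie,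
      ← LieModuleHom.map_lie, h0, map_zero]
  exact toFactor_eq_zero.1 h1

theorem LIsomorphic.isAbelianFactor {A₁ B₁ A₂ B₂ : LieIdeal F L}
    (h : LIsomorphic A₁ B₁ A₂ B₂) (hab : IsAbelianFactor A₁ B₁) : IsAbelianFactor A₂ B₂ := by
  obtain ⟨e, he⟩ := h
  intro a ha b hb
  obtain ⟨x, hx⟩ := LIsomorphic.exists_apply_eq e ⟨a, ha⟩
  obtain ⟨y, hy⟩ := LIsomorphic.exists_apply_eq e ⟨b, hb⟩
  have h0 : toFactor A₁ B₁ ⁅x, y⁆ = 0 := toFactor_eq_zero.2 (hab x x.2 y y.2)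
  have h1 := he x y _ _ hx hy
  rw [h0, map_zero] at h1
  exact toFactor_eq_zero.1 h1.symm

/-- Connected chief factors are isomorphic, or both are non-abelian. -/
theorem LConnected.lIsomorphic_or {A₁ B₁ A₂ B₂ : LieIdeal F L} (h : LConnected A₁ B₁ A₂ B₂) :
    LIsomorphic A₁ B₁ A₂ B₂ ∨ ¬ IsAbelianFactor A₁ B₁ ∧ ¬ IsAbelianFactor A₂ B₂ := by
  refine h.imp_right ?_
  rintro ⟨N, E₁, E₂, hT, hE₁, hE₂, -, h₁, h₂⟩
  have key : ∀ E : LieIdeal F L, IsChiefFactor E N → ¬ IsAbelianFactor E N := fun E hE hab =>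
    hT.not_isLieAbelian (isAtom_map_quotientHom hE) (isLieAbelian_map_quotientHom_iff.2 hab)
  exact ⟨fun hab => key E₁ hE₁ (h₁.symm.isAbelianFactor hab),
    fun hab => key E₂ hE₂ (h₂.symm.isAbelianFactor hab)⟩

/-! ### Crowns -/

theorem Supplements.le_core {M : LieSubalgebra F L} {E D : LieIdeal F L} (h : Supplements M E D) :
    D ≤ core M :=
  LieCrown.le_core (h.2.2.trans inf_le_right)

theorem Supplements.not_le {M : LieSubalgebra F L} {E D : LieIdeal F L} (h : Supplements M E D) :
    ¬ E ≤ core M := by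
  intro hle
  apply h.1
  have hEM : E.toSubmodule ≤ M.toSubmodule := le_trans hle (core_le M)
  rw [← LieSubalgebra.toSubmodule_inj, LieSubalgebra.top_toSubmodule, ← h.2.1]
  exact (sup_eq_right.2 hEM).symm

theorem Supplements.inf_core {M : LieSubalgebra F L} {E D : LieIdeal F L} (h : Supplements M E D)
    (hE : IsChiefFactor E D) : E ⊓ core M = D :=
  (hE.eq_or_eq (le_inf hE.le h.le_core) inf_le_left).resolve_right
    fun h1 => h.not_le (inf_eq_left.1 h1)

theorem radical_le_core [FiniteDimensional F L] {M : LieSubalgebra F L} {E D : LieIdeal F L}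
    (hM : IsMonolithicMaximal M) (hE : IsChiefFactor E D) (hna : ¬ IsAbelianFactor E D)
    (hs : Supplements M E D) : LieAlgebra.radical F L ≤ core M := by
  have hinf := hs.inf_core hE
  have hatom := hE.isAtom_map hinf
  refine radical_le_of_isAtom fun W hW hab => ?_
  rw [hM.2.2.unique hW hatom, isLieAbelian_map_quotientHom_iff] at hab
  refine hna fun x hx y hy => ?_
  rw [← hinf]
  exact ⟨E.lie_mem hy, hab x hx y hy⟩

/-- A supplement `M` of an abelian factor `E / D` satisfies `C_L(E/D) ⊆ E + M_L`. -/
theorem Supplements.factorCentralizer_le {M : LieSubalgebra F L} {E D : LieIdeal F L}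
    (hs : Supplements M E D) (hab : IsAbelianFactor E D) :
    factorCentralizer E D ≤ E ⊔ core M := by
  have hDM : D.toSubmodule ≤ M.toSubmodule := hs.2.2.trans inf_le_right
  -- `C_L(E/D) ∩ M` is normalised by `M`, and `E` maps it into `D`.
  let J : LieIdeal F L :=
    { (factorCentralizer E D).toSubmodule ⊓ M.toSubmodule with
      lie_mem := by
        intro x c hc
        obtain ⟨hc, hcM⟩ := hc
        refine ⟨(factorCentralizer E D).lie_mem hc, ?_⟩
        have hx : x ∈ E.toSubmodule ⊔ M.toSubmodule := by rw [hs.2.1]; trivial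
        obtain ⟨e, he, m, hm, rfl⟩ := Submodule.mem_sup.1 hx
        rw [add_lie]
        refine add_mem ?_ (M.lie_mem hm hcM)
        rw [← lie_skew]
        exact neg_mem (hDM (hc e he)) }
  have hJ : J ≤ core M := LieCrown.le_core fun x hx => hx.2
  intro c hc
  have hcT : c ∈ E.toSubmodule ⊔ M.toSubmodule := by rw [hs.2.1]; trivial
  obtain ⟨e, he, m, hm, rfl⟩ := Submodule.mem_sup.1 hcT
  refine add_mem ((le_sup_left : E ≤ E ⊔ core M) he) ((le_sup_right : core M ≤ E ⊔ core M) (hJ ?_))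
  refine ⟨?_, hm⟩
  have := sub_mem hc (isAbelianFactor_iff_le_factorCentralizer.1 hab he)
  rwa [add_sub_cancel_left] at this

/-- The crown associated with an abelian chief factor is abelian. -/
theorem isAbelianFactor_crown {A B : LieIdeal F L} (hab : IsAbelianFactor A B) :
    IsAbelianFactor (crownTop A B) (crownBot A B) := by
  rw [isAbelianFactor_iff_lie_le]
  refine le_sInf ?_
  rintro _ ⟨M, rfl, -, E, D, -, hconn, hs⟩
  have hiso : LIsomorphic E D A B := hconn.lIsomorphic_or.resolve_right fun h => h.2 hab
  have habE : IsAbelianFactor E D := hiso.symm.isAbelianFactor hab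
  have hR : crownTop A B ≤ E ⊔ core M :=
    (sup_le (isAbelianFactor_iff_le_factorCentralizer.1 hab) le_rfl).trans
      (hiso.symm.factorCentralizer_le.trans (hs.factorCentralizer_le habE))
  refine (LieSubmodule.mono_lie hR hR).trans ?_
  rw [LieSubmodule.lie_sup, LieSubmodule.sup_lie]
  exact sup_le (sup_le ((isAbelianFactor_iff_lie_le.1 habE).trans hs.le_core)
    (LieSubmodule.lie_le_left _ _)) (LieSubmodule.lie_le_right _ _)

theorem radical_le_crownBot [FiniteDimensional F L] {A B : LieIdeal F L}
    (hna : ¬ IsAbelianFactor A B) : LieAlgebra.radical F L ≤ crownBot A B := by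
  refine le_sInf ?_
  rintro _ ⟨M, rfl, hM, E, D, hE, hconn, hs⟩
  refine radical_le_core hM hE (fun hab => ?_) hs
  rcases hconn.lIsomorphic_or with h | h
  · exact hna (h.isAbelianFactor hab)
  · exact h.1 hab

/-- A non-abelian chief factor has a non-abelian crown, whose denominator centralises the factor. -/
theorem IsChiefFactor.exists_crown [FiniteDimensional F L] {A B : LieIdeal F L}
    (h : IsChiefFactor A B) (hna : ¬ IsAbelianFactor A B) :
    IsCrown (crownTop A B) (crownBot A B) ∧ ¬ IsAbelianFactor (crownTop A B) (crownBot A B) ∧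
      crownBot A B ≤ factorCentralizer A B := by
  obtain ⟨M, hcore, hM, hT, hs⟩ := exists_isCoatom_core_eq_factorCentralizer h hna
  have hle : crownBot A B ≤ factorCentralizer A B := by
    refine sInf_le ⟨M, hcore.symm, ⟨hM, hT.1, ?_⟩, A, B, h, Or.inl (LIsomorphic.refl A B), hs⟩
    obtain ⟨-, W, hW, -⟩ := hT
    exact ⟨W, hW.superset rfl, fun V hV => hW.subset hV⟩
  refine ⟨⟨A, B, h, ⟨M, hs⟩, rfl, rfl⟩, fun hab => hna fun x hx y hy => ?_, hle⟩
  rw [← h.inf_factorCentralizer hna]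
  have hA : A ≤ crownTop A B := le_sup_left
  exact ⟨A.lie_mem hy, hle (hab x (hA hx) y (hA hy))⟩

end LieCrown

theorem propositionp {F L : Type*} [Field F] [LieRing L] [LieAlgebra F L]
    [FiniteDimensional F L] :
    sInf {S : LieIdeal F L | ∃ R : LieIdeal F L,
        LieCrown.IsCrown R S ∧ ¬ LieCrown.IsAbelianFactor R S} =
      LieAlgebra.radical F L ∧
    sInf {N : LieIdeal F L | ∃ M : LieSubalgebra F L, N = LieCrown.core M ∧ IsCoatom M ∧
        LieCrown.IsPrimitiveType2 F (L ⧸ LieCrown.core M)} =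
      LieAlgebra.radical F L ∧
    sInf {N : LieIdeal F L | ∃ M : LieSubalgebra F L, N = LieCrown.core M ∧ IsCoatom M ∧
        (LieCrown.IsPrimitiveType2 F (L ⧸ LieCrown.core M) ∨
          LieCrown.IsPrimitiveType3 F (L ⧸ LieCrown.core M))} =
      LieAlgebra.radical F L ∧
    sInf {C : LieIdeal F L | ∃ A B : LieIdeal F L, LieCrown.IsChiefFactor A B ∧
        ¬ LieCrown.IsAbelianFactor A B ∧ C = LieCrown.factorCentralizer A B} =
      LieAlgebra.radical F L := by
  refine ⟨le_antisymm ?_ (le_sInf ?_), le_antisymm ?_ (le_sInf ?_),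
    le_antisymm ?_ (le_sInf ?_), le_antisymm ?_ (le_sInf ?_)⟩
  · refine LieCrown.le_radical_of_forall_le_factorCentralizer fun A B h hna => ?_
    obtain ⟨hcrown, hab, hle⟩ := h.exists_crown hna
    exact (sInf_le (show _ ∈ {S | ∃ R, _} from ⟨_, hcrown, hab⟩)).trans hle
  · rintro _ ⟨_, ⟨A, B, -, -, rfl, rfl⟩, hna⟩
    exact LieCrown.radical_le_crownBot fun hab => hna (LieCrown.isAbelianFactor_crown hab)
  · refine LieCrown.le_radical_of_forall_le_factorCentralizer fun A B h hna => ?_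
    obtain ⟨M, hcore, hM, hT, -⟩ := LieCrown.exists_isCoatom_core_eq_factorCentralizer h hna
    exact sInf_le ⟨M, hcore.symm, hM, hT⟩
  · rintro _ ⟨M, rfl, -, hT⟩
    exact LieCrown.radical_le_of_isAtom fun W hW => hT.not_isLieAbelian hW
  · refine LieCrown.le_radical_of_forall_le_factorCentralizer fun A B h hna => ?_
    obtain ⟨M, hcore, hM, hT, -⟩ := LieCrown.exists_isCoatom_core_eq_factorCentralizer h hna
    exact sInf_le ⟨M, hcore.symm, hM, Or.inl hT⟩
  · rintro _ ⟨M, rfl, -, hT | hT⟩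
    · exact LieCrown.radical_le_of_isAtom fun W hW => hT.not_isLieAbelian hW
    · exact LieCrown.radical_le_of_isAtom fun W hW => hT.not_isLieAbelian hW
  · exact LieCrown.le_radical_of_forall_le_factorCentralizer fun A B h hna =>
      sInf_le ⟨A, B, h, hna, rfl⟩
  · rintro _ ⟨A, B, h, hna, rfl⟩
    exact LieCrown.radical_le_factorCentralizer h hna
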